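/- Let $n\ge 3$ and let $V=S+F$ be a real $n\times n$ matrix with $S^\top=S$ and $F^\top=-F$. For $A\in\mathbb R^{n\times n}$ let $\bar\alpha^{A}$ be the 1-form on the unit sphere $\mathbb S^{n-1}\subset\mathbb R^n$ given by $\bar\alpha^{A}_\rho(\eta)=\langle\eta,(I-\rho\rho^\top)A\rho\rangle$ for $\rho\in\mathbb S^{n-1}$, $\eta\perp\rho$; that is, $\bar\alpha^A$ is the restriction of $(A\rho)^\top d\rho$. For nonempty $J\subseteq\{1,\dots,n\}$ let $$\mathcal M_J=\Bigl\{q\in\mathbb R^n:\ q_i>0\ (i\in J),\ q_i=0\ (i\notin J),\ \sum_i q_i=1\Bigr\},$$ with tangent space $T_J=\{v\in\mathbb R^n: v_i=0\ (i\notin J),\ \sum_i v_i=0\}$; thus $\mathcal M=\mathcal M_{\{1,\dots,n\}}$ is the open simplex and the other $\mathcal M_J$ are its open proper faces. Let $\iota(q)=\sqrt q=(\sqrt{q_1},\dots,\sqrt{q_n})$, let $\beta_J^{A}=(\iota|_{\mathcal M_J})^*\bar\alpha^{A}$, $\beta_J=\beta_J^V$, and let $g_F(q)[v,w]=\sum_{i\in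 J}v_iw_i/q_i$ be the Fisher–Rao metric on $\mathcal M_J$. For a smooth 2-form $\gamma$ let $\delta_{g_F}\gamma$ be its codifferential, given in coordinates by $(\delta_{g}\gamma)^j=-|g|^{-1/2}\sum_i\partial_i(|g|^{1/2}\gamma^{ij})$, $|g|=\det(g_{ij})$. Then on $\mathcal M$, and likewise on every face $\mathcal M_J$ with $J$ nonempty, $\beta_J$ is a smooth 1-form, $\beta_J=\beta_J^{S}+\beta_J^{F}$, and: 1. (Utility, exact part.) The function $U(q)=\tfrac12(\sqrt q)^\top S\sqrt q$ is smooth on $\mathcal M_J$ and $\beta_J^{S}=dU$. 2. (Co-utility, co-exact part.) If $|J|\ge 3$ (in particular on $\mathcal M$), there is a smooth 2-form $\gamma$ on $\mathcal M_J$ such that $\beta_J^{F}=\delta_{g_F}\gamma$; equivalently, $\beta_J=dU+\delta_{g_F}\gamma$. -/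

import Mathlib

open scoped Matrix ContDiff

noncomputable section

namespace PrefSimplex

variable {n : ℕ}

/-! ### The open simplex, its open faces, and calculus on them -/

/-- The open face of the simplex in `ℝⁿ` with support exactly `J`.
For `J = Finset.univ` this is the open simplex `{q | ∀ i, 0 < q i, ∑ i, q i = 1}`. -/
def openFace (J : Finset (Fin n)) : Set (Fin n → ℝ) :=
  {q | (∀ i ∈ J, 0 < q i) ∧ (∀ i ∉ J, q i = 0) ∧ ∑ i, q i = 1}

theorem mem_openFace_univ (q : Fin n → ℝ) :
    q ∈ openFace Finset.univ ↔ (∀ i, 0 < q i) ∧ ∑ i, q i = 1 := by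
  simp [openFace]

/-- The tangent space of `openFace J` (the same at each of its points). -/
def faceTangent (J : Finset (Fin n)) : Submodule ℝ (Fin n → ℝ) where
  carrier := {v | (∀ i ∉ J, v i = 0) ∧ ∑ i, v i = 0}
  zero_mem' := by simp
  add_mem' := by
    rintro v w ⟨hv, hv'⟩ ⟨hw, hw'⟩
    refine ⟨fun i hi => by simp [hv i hi, hw i hi], ?_⟩
    simp [Finset.sum_add_distrib, hv', hw']
  smul_mem' := by
    rintro c v ⟨hv, hv'⟩
    refine ⟨fun i hi => by simp [hv i hi], ?_⟩
    simp [← Finset.mul_sum, hv']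

section Calculus

variable {W : Type*} [NormedAddCommGroup W] [NormedSpace ℝ W]

/-- Smoothness of a function (or of a differential form, as a function with values in
alternating forms on the fixed tangent space) on the open face, which is an open subset of
the affine space `q + faceTangent J`. Values of `f` away from the face play no role. -/
def FaceSmooth (J : Finset (Fin n)) (f : (Fin n → ℝ) → W) : Prop :=
  ∀ q ∈ openFace J, ContDiffAt ℝ ∞ (fun v : faceTangent J => f (q + v)) 0

/-- The differential at `q` of a function on the open face. -/
def faceDeriv (J : Finset (Fin n)) (f : (Fin n → ℝ) → W) (q : Fin n → ℝ) :
    faceTangent J →L[ℝ] W :=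
  fderiv ℝ (fun v : faceTangent J => f (q + v)) 0

end Calculus

/-- A (not necessarily smooth) differential `1`-form on the open face. -/
abbrev OneForm (J : Finset (Fin n)) : Type := (Fin n → ℝ) → faceTangent J →L[ℝ] ℝ

/-- A (not necessarily smooth) differential `2`-form on the open face. -/
abbrev TwoForm (J : Finset (Fin n)) : Type := (Fin n → ℝ) → faceTangent J [⋀^Fin 2]→L[ℝ] ℝ

/-! ### Riemannian metrics and the codifferential of `2`-forms -/

/-- A field of bilinear forms on the tangent spaces of the open face. -/
abbrev MetricField (J : Finset (Fin n)) : Type :=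
  (Fin n → ℝ) → LinearMap.BilinForm ℝ (faceTangent J)

/-- The Fisher–Rao metric `g_F(q)[v, w] = ∑ i, v i * w i / q i`, the sum being over the support. -/
def fisherRao (J : Finset (Fin n)) : MetricField J := fun q =>
  LinearMap.mk₂ ℝ (fun v w : faceTangent J => ∑ i ∈ J, (v : Fin n → ℝ) i * (w : Fin n → ℝ) i / q i)
    (fun v v' w => by simp [add_mul, add_div, Finset.sum_add_distrib])
    (fun c v w => by simp [Finset.mul_sum, mul_assoc, mul_div_assoc])
    (fun v w w' => by simp [mul_add, add_div, Finset.sum_add_distrib])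
    (fun c v w => by simp [Finset.mul_sum, mul_left_comm, mul_div_assoc])

section Codifferential

variable {J : Finset (Fin n)} {κ : Type*} [Fintype κ] [DecidableEq κ]

/-- The matrix `g_{ij}` of a metric at `q`, in the linear coordinates given by the basis `b`. -/
def gram (b : Module.Basis κ ℝ (faceTangent J)) (g : MetricField J) (q : Fin n → ℝ) :
    Matrix κ κ ℝ :=
  Matrix.of fun i j => g q (b i) (b j)

/-- The components `γ_{ij}` of a `2`-form at `q`. -/
def comps (b : Module.Basis κ ℝ (faceTangent J)) (γ : TwoForm J) (q : Fin n → ℝ) :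
    Matrix κ κ ℝ :=
  Matrix.of fun i j => γ q ![b i, b j]

/-- The components `γ^{ij} = g^{ik} g^{jl} γ_{kl}` of a `2`-form with both indices raised. -/
def raised (b : Module.Basis κ ℝ (faceTangent J)) (g : MetricField J) (γ : TwoForm J)
    (q : Fin n → ℝ) : Matrix κ κ ℝ :=
  (gram b g q)⁻¹ * comps b γ q * ((gram b g q)⁻¹)ᵀ

/-- The codifferential of a `2`-form in the linear coordinates given by the basis `b`:
`(δ_g γ)^j = - |g|^{-1/2} ∑ i, ∂_i (|g|^{1/2} γ^{ij})` with `|g| = det g_{ij}`, and then the index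
`j` is lowered with `g`. -/
def codiffIn (b : Module.Basis κ ℝ (faceTangent J)) (g : MetricField J) (γ : TwoForm J)
    (q : Fin n → ℝ) (v : faceTangent J) : ℝ :=
  ∑ j, (-((√(gram b g q).det)⁻¹ *
      ∑ i, faceDeriv J (fun x => √(gram b g x).det * raised b g γ x i j) q (b i))) * g q (b j) v

/-- The codifferential does not depend on the linear coordinates. -/
theorem codiffIn_eq (b b' : Module.Basis κ ℝ (faceTangent J)) (g : MetricField J) (γ : TwoForm J)
    (q : Fin n → ℝ)
    (hd : ∀ i j, DifferentiableAt ℝ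
      (fun v : faceTangent J => √(gram b g (q + v)).det * raised b g γ (q + v) i j) 0)
    (v : faceTangent J) : codiffIn b' g γ q v = codiffIn b g γ q v := by
  set P : Matrix κ κ ℝ := b.toMatrix b' with hPdef
  have hPI : P * b'.toMatrix b = 1 := b.toMatrix_mul_toMatrix_flip b'
  have hIP : b'.toMatrix b * P = 1 := b'.toMatrix_mul_toMatrix_flip b
  have hinv : P⁻¹ = b'.toMatrix b := Matrix.inv_eq_right_inv hPI
  set R : Matrix κ κ ℝ := b'.toMatrix b with hR
  have hb' : ∀ i, b' i = ∑ k, P k i • b k := fun i => (b.sum_toMatrix_smul_self b' i).symm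
  have hdet : P.det ≠ 0 := fun h => by
    have := congrArg Matrix.det hPI
    simp [h] at this
  have hgram : ∀ x, gram b' g x = Pᵀ * gram b g x * P := by
    intro x
    ext i j
    simp only [gram, Matrix.of_apply, hb', map_sum, map_smul, LinearMap.sum_apply,
      LinearMap.smul_apply, Matrix.mul_apply, Matrix.transpose_apply, smul_eq_mul, Finset.sum_mul,
      Finset.mul_sum]
    refine Finset.sum_congr rfl fun k _ => Finset.sum_congr rfl fun l _ => by ring
  have hcomps : ∀ x, comps b' γ x = Pᵀ * comps b γ x * P := by
    intro x
    have hB : ∃ B : faceTangent J →ₗ[ℝ] faceTangent J →ₗ[ℝ] ℝ, ∀ u w, B u w = γ x ![u, w] := by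
      refine ⟨LinearMap.mk₂ ℝ (fun u w => γ x ![u, w]) ?_ ?_ ?_ ?_, fun u w => rfl⟩
      · intro u u' w; exact (γ x).toContinuousMultilinearMap.toMultilinearMap.cons_add ![w] u u'
      · intro c u w; exact (γ x).toContinuousMultilinearMap.toMultilinearMap.cons_smul ![w] c u
      · intro u w w'
        have h := (γ x).map_update_add ![u, w] 1 w w'
        have e : ∀ z, Function.update ![u, w] 1 z = ![u, z] := fun z => by
          funext t; fin_cases t <;> rfl
        simp only [e] at h
        exact h
      · intro c u w
        have h := (γ x).map_update_smul ![u, w] 1 c w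
        have e : ∀ z, Function.update ![u, w] 1 z = ![u, z] := fun z => by
          funext t; fin_cases t <;> rfl
        simp only [e] at h
        exact h
    obtain ⟨B, hB⟩ := hB
    ext i j
    simp only [comps, Matrix.of_apply, ← hB]
    simp only [hb', map_sum, map_smul, LinearMap.sum_apply,
      LinearMap.smul_apply, Matrix.mul_apply, Matrix.transpose_apply, smul_eq_mul, Finset.sum_mul,
      Finset.mul_sum, Matrix.of_apply]
    refine Finset.sum_congr rfl fun k _ => Finset.sum_congr rfl fun l _ => by ring
  have hginv : ∀ x, (gram b' g x)⁻¹ = R * (gram b g x)⁻¹ * Rᵀ := by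
    intro x
    rw [hgram, Matrix.mul_inv_rev, Matrix.mul_inv_rev, ← Matrix.transpose_nonsing_inv, hinv,
      Matrix.mul_assoc]
  have hraised : ∀ x, raised b' g γ x = R * raised b g γ x * Rᵀ := by
    intro x
    have h1 : Rᵀ * Pᵀ = 1 := by rw [← Matrix.transpose_mul, hPI, Matrix.transpose_one]
    simp only [raised, hginv, hcomps, Matrix.transpose_mul, Matrix.transpose_transpose]
    calc R * (gram b g x)⁻¹ * Rᵀ * (Pᵀ * comps b γ x * P) * (R * ((gram b g x)⁻¹ᵀ * Rᵀ))
        = R * (gram b g x)⁻¹ * (Rᵀ * Pᵀ) * comps b γ x * (P * R) * (gram b g x)⁻¹ᵀ * Rᵀ := by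
          simp only [Matrix.mul_assoc]
      _ = _ := by rw [h1, hPI]; simp only [Matrix.mul_one, Matrix.mul_assoc]
  have hsqrt : ∀ x, √(gram b' g x).det = |P.det| * √(gram b g x).det := by
    intro x
    rw [hgram, Matrix.det_mul, Matrix.det_mul, Matrix.det_transpose,
      show P.det * (gram b g x).det * P.det = P.det ^ 2 * (gram b g x).det by ring,
      Real.sqrt_mul (sq_nonneg _), Real.sqrt_sq_eq_abs]
  have hder : ∀ i j (u : faceTangent J),
      faceDeriv J (fun x => √(gram b' g x).det * raised b' g γ x i j) q u =
        |P.det| * ∑ k, ∑ l, R i k * R j l *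
          faceDeriv J (fun x => √(gram b g x).det * raised b g γ x k l) q u := by
    intro i j u
    have hf : (fun w : faceTangent J => √(gram b' g (q + w)).det * raised b' g γ (q + w) i j) =
        fun w : faceTangent J => |P.det| * ∑ k, ∑ l, R i k * R j l *
          (√(gram b g (q + w)).det * raised b g γ (q + w) k l) := by
      funext w
      rw [hsqrt, hraised]
      simp only [Matrix.mul_apply, Matrix.transpose_apply, Finset.sum_mul, Finset.mul_sum]
      rw [Finset.sum_comm]
      refine Finset.sum_congr rfl fun k _ => Finset.sum_congr rfl fun l _ => by ring
    unfold faceDeriv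
    have h := HasFDerivAt.const_mul (HasFDerivAt.fun_sum (u := Finset.univ) fun k _ =>
      HasFDerivAt.fun_sum (u := Finset.univ) fun l _ =>
        ((hd k l).hasFDerivAt.const_mul (R i k * R j l))) |P.det|
    rw [hf, h.fderiv]
    simp
  have hb : ∀ k, b k = ∑ i, R i k • b' i := fun k => (b'.sum_toMatrix_smul_self b k).symm
  have habs : |P.det| ≠ 0 := abs_ne_zero.mpr hdet
  have hc : ∀ (s : ℝ) (A : κ → κ → κ → ℝ) (G : κ → ℝ),
      ∑ j, (-((|P.det| * s)⁻¹ * ∑ i, |P.det| * ∑ k, ∑ l, R i k * R j l * A k l i)) * G j =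
        ∑ l, (-(s⁻¹ * ∑ k, ∑ i, R i k * A k l i)) * ∑ j, R j l * G j := by
    intro s A G
    have e : ∀ j, (|P.det| * s)⁻¹ * ∑ i, |P.det| * ∑ k, ∑ l, R i k * R j l * A k l i =
        ∑ l, R j l * (s⁻¹ * ∑ k, ∑ i, R i k * A k l i) := by
      intro j
      have e1 : ∑ i, ∑ k, ∑ l, R i k * R j l * A k l i =
          ∑ l, R j l * ∑ k, ∑ i, R i k * A k l i := by
        simp only [Finset.mul_sum]
        rw [Finset.sum_comm]
        conv_lhs => enter [2, k]; rw [Finset.sum_comm]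
        rw [Finset.sum_comm]
        refine Finset.sum_congr rfl fun l _ => Finset.sum_congr rfl fun k _ =>
          Finset.sum_congr rfl fun i _ => by ring
      have e2 : (|P.det| * s)⁻¹ * |P.det| = s⁻¹ := by
        rw [mul_inv, mul_right_comm, inv_mul_cancel₀ habs, one_mul]
      rw [← Finset.mul_sum, ← mul_assoc, e2, e1, Finset.mul_sum]
      exact Finset.sum_congr rfl fun l _ => by ring
    simp only [e]
    have e3 : ∀ T : κ → ℝ, ∑ j, (-∑ l, R j l * T l) * G j = ∑ l, (-T l) * ∑ j, R j l * G j := by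
      intro T
      simp only [neg_mul, Finset.sum_neg_distrib, Finset.sum_mul, Finset.mul_sum]
      rw [Finset.sum_comm]
      exact congrArg _ (Finset.sum_congr rfl fun l _ => Finset.sum_congr rfl fun j _ => by ring)
    exact e3 _
  have hR1 : ∀ k l, faceDeriv J (fun x => √(gram b g x).det * raised b g γ x k l) q (b k) =
      ∑ i, R i k * faceDeriv J (fun x => √(gram b g x).det * raised b g γ x k l) q (b' i) := by
    intro k l
    rw [hb k, map_sum]
    simp only [map_smul, smul_eq_mul]
  have hR2 : ∀ l, g q (b l) v = ∑ j, R j l * g q (b' j) v := by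
    intro l
    rw [hb l, map_sum, LinearMap.sum_apply]
    simp only [map_smul, LinearMap.smul_apply, smul_eq_mul]
  unfold codiffIn
  simp only [hR1, hR2, hder]
  rw [hsqrt]
  exact hc _ (fun k l i => faceDeriv J (fun x => √(gram b g x).det * raised b g γ x k l) q (b' i))
    (fun j => g q (b' j) v)

/-- The codifferential `δ_g γ` of a `2`-form, evaluated at the point `q` on the tangent vector `v`.
The value does not depend on the basis, see `codiffIn_eq`. -/
def codifferential (g : MetricField J) (γ : TwoForm J) (q : Fin n → ℝ) (v : faceTangent J) : ℝ :=
  codiffIn (Module.finBasis ℝ (faceTangent J)) g γ q v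

end Codifferential

/-! ### The preference form -/

/-- The projector `Q_ρ = I - ρ ρᵀ`, which is orthogonal onto `T_ρ S^{n-1}` for `ρ` on the sphere. -/
def tangentProj (ρ : Fin n → ℝ) : Matrix (Fin n) (Fin n) ℝ := 1 - Matrix.vecMulVec ρ ρ

/-- The spherical preference form `η ↦ ⟨η, Q_ρ V ρ⟩`, a `1`-form on the unit sphere
(to be evaluated at unit vectors `ρ` and on vectors `η` orthogonal to `ρ`). -/
def sphereForm (V : Matrix (Fin n) (Fin n) ℝ) (ρ : Fin n → ℝ) : (Fin n → ℝ) →L[ℝ] ℝ :=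
  ∑ i, (tangentProj ρ *ᵥ (V *ᵥ ρ)) i • ContinuousLinearMap.proj i

/-- The square-root lift `q ↦ √q` from the simplex to the sphere. -/
def sqrtLift (q : Fin n → ℝ) : Fin n → ℝ := fun i => √(q i)

/-- The marginal preference covector `β`: the pullback of the spherical preference form along the
square-root lift of the open face. -/
def prefForm (J : Finset (Fin n)) (V : Matrix (Fin n) (Fin n) ℝ) : OneForm J := fun q =>
  (sphereForm V (sqrtLift q)).comp (faceDeriv J sqrtLift q)

/-- The potential `U(q) = ½ (√q)ᵀ S √q`. -/
def utility (S : Matrix (Fin n) (Fin n) ℝ) (q : Fin n → ℝ) : ℝ :=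
  (1 / 2) * (sqrtLift q ⬝ᵥ (S *ᵥ sqrtLift q))

end PrefSimplex

end

open PrefSimplex

/-!
Everything is written in the square-root chart `s = √q`. Since `d√q` is tangent to the sphere, the
projector drops out and the preference form of any matrix `A` is `∑ (A s)_i dq_i / (2 s_i)`
(`prefForm_eq`). For a symmetric matrix this is visibly the differential of `½ sᵀ S s`.

For an antisymmetric matrix `F` the form is, on the sphere, dual to the Killing field `ρ ↦ F ρ`, and
the Fisher–Rao metric is four times the round metric. On the sphere of dimension `m = |J| - 1` a
Killing `1`-form `α` satisfies `δ dα = 2 Ric α = 2 (m - 1) α`, so `α` is co-exact with primitive a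
multiple of `dα`, as soon as `|J| ≥ 3`. In the coordinate `q` this primitive is
`γ = c ∑ F_{ab} (s_a s_b)⁻¹ dq_a ⊗ dq_b` with `c = -(|J| - 2)⁻¹` (`coutilityForm`).

The identity `δ γ = β^F` is verified by direct computation in the linear coordinates given by the
vectors `e_a - e_o`, with `o` a fixed element of `J`; `codiffIn_eq` allows this change of basis.
There `|g| = ∏ q_a⁻¹` and `g⁻¹ = diag q - q qᵀ`, which give
`γ^{ij} = c (s_i s_j F_{ij} - s_i (F s)_i q_j + q_i s_j (F s)_j)` (`raised_coutilityForm`). As the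
columns of `γ^{ij}` sum to zero on the face, the coordinate divergence can be computed from ambient
derivatives, and the result is `(|J| / 2 - 1) c s_j (F s)_j` times the density
(`sum_raisedCompDeriv_basis`).
-/

noncomputable section

namespace PrefSimplex

open Filter Topology

variable {n : ℕ} {J : Finset (Fin n)} {q : Fin n → ℝ}

/-! ### Calculus of the square-root lift on a face -/

/-- The `i`-th coordinate as a continuous linear form on the tangent space of a face. -/
def tangentCoord (J : Finset (Fin n)) (i : Fin n) : faceTangent J →L[ℝ] ℝ :=
  (ContinuousLinearMap.proj i : (Fin n → ℝ) →L[ℝ] ℝ).comp (faceTangent J).subtypeL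

@[simp] theorem tangentCoord_apply (i : Fin n) (v : faceTangent J) :
    tangentCoord J i v = (v : Fin n → ℝ) i := rfl

theorem eventually_mem_openFace (hq : q ∈ openFace J) :
    ∀ᶠ v : faceTangent J in 𝓝 0, q + (v : Fin n → ℝ) ∈ openFace J := by
  have h : ∀ᶠ v : faceTangent J in 𝓝 0, ∀ i ∈ J, 0 < q i + (v : Fin n → ℝ) i := by
    rw [Filter.eventually_all_finset]
    intro i hi
    have hc : ContinuousAt (fun v : faceTangent J => q i + tangentCoord J i v) 0 := by fun_prop
    exact hc.eventually_const_lt (by simpa using hq.1 i hi)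
  filter_upwards [h] with v hv
  refine ⟨hv, fun i hi => ?_, ?_⟩
  · simp [hq.2.1 i hi, v.2.1 i hi]
  · simp [Finset.sum_add_distrib, hq.2.2, v.2.2]

theorem FaceSmooth.congr {W : Type*} [NormedAddCommGroup W] [NormedSpace ℝ W]
    {f g : (Fin n → ℝ) → W} (hg : FaceSmooth J g) (h : ∀ q ∈ openFace J, f q = g q) :
    FaceSmooth J f := fun q hq =>
  (hg q hq).congr_of_eventuallyEq <| (eventually_mem_openFace hq).mono fun _ hv => h _ hv

theorem FaceSmooth.smul_const {W : Type*} [NormedAddCommGroup W] [NormedSpace ℝ W]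
    {f : (Fin n → ℝ) → ℝ} (hf : FaceSmooth J f) (w : W) : FaceSmooth J fun q => f q • w :=
  fun q hq => (hf q hq).smul contDiffAt_const

theorem FaceSmooth.sum {W ι : Type*} [NormedAddCommGroup W] [NormedSpace ℝ W] {t : Finset ι}
    {f : ι → (Fin n → ℝ) → W} (hf : ∀ i ∈ t, FaceSmooth J (f i)) :
    FaceSmooth J fun q => ∑ i ∈ t, f i q :=
  fun q hq => ContDiffAt.sum fun i hi => hf i hi q hq

theorem FaceSmooth.mul {f g : (Fin n → ℝ) → ℝ} (hf : FaceSmooth J f) (hg : FaceSmooth J g) :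
    FaceSmooth J fun q => f q * g q :=
  fun q hq => (hf q hq).mul (hg q hq)

theorem faceSmooth_const {W : Type*} [NormedAddCommGroup W] [NormedSpace ℝ W] (w : W) :
    FaceSmooth J fun _ => w :=
  fun _ _ => contDiffAt_const

theorem sqrtLift_pos (hq : q ∈ openFace J) {i : Fin n} (hi : i ∈ J) : 0 < sqrtLift q i :=
  Real.sqrt_pos.2 (hq.1 i hi)

theorem sqrtLift_eq_zero (hq : q ∈ openFace J) {i : Fin n} (hi : i ∉ J) : sqrtLift q i = 0 := by
  simp [sqrtLift, hq.2.1 i hi]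

theorem sqrtLift_sq (hq : q ∈ openFace J) (i : Fin n) : sqrtLift q i ^ 2 = q i := by
  refine Real.sq_sqrt ?_
  by_cases hi : i ∈ J
  · exact (hq.1 i hi).le
  · exact (hq.2.1 i hi).ge

theorem sum_sqrtLift_sq (hq : q ∈ openFace J) : ∑ i, sqrtLift q i ^ 2 = 1 := by
  simp only [sqrtLift_sq hq, hq.2.2]

/-- Off the support, both sides are zero: `√q i` stays `0` along the face, and `0⁻¹ = 0`. -/
theorem hasFDerivAt_sqrtLift (hq : q ∈ openFace J) (i : Fin n) :
    HasFDerivAt (fun v : faceTangent J => sqrtLift (q + (v : Fin n → ℝ)) i)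
      ((2 * sqrtLift q i)⁻¹ • tangentCoord J i) 0 := by
  by_cases hi : i ∈ J
  · have h1 : HasFDerivAt (fun v : faceTangent J => q i + tangentCoord J i v)
        (tangentCoord J i) 0 := (tangentCoord J i).hasFDerivAt.const_add (q i)
    have h2 := h1.sqrt (by simpa using (hq.1 i hi).ne')
    simpa [sqrtLift] using h2
  · have h1 : (fun v : faceTangent J => sqrtLift (q + (v : Fin n → ℝ)) i) = fun _ => 0 := by
      funext v
      simp [sqrtLift, hq.2.1 i hi, v.2.1 i hi]
    rw [h1, sqrtLift_eq_zero hq hi]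
    simpa using hasFDerivAt_const (0 : ℝ) (0 : faceTangent J)

theorem faceSmooth_sqrtLift (i : Fin n) : FaceSmooth J fun q => sqrtLift q i := by
  intro q hq
  by_cases hi : i ∈ J
  · have h1 : ContDiffAt ℝ ∞ (fun v : faceTangent J => q i + tangentCoord J i v) 0 := by fun_prop
    exact h1.sqrt (by simpa using (hq.1 i hi).ne')
  · have h1 : (fun v : faceTangent J => sqrtLift (q + (v : Fin n → ℝ)) i) = fun _ => 0 := by
      funext v
      simp [sqrtLift, hq.2.1 i hi, v.2.1 i hi]
    rw [h1]
    exact contDiffAt_const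

theorem faceSmooth_inv_sqrtLift (i : Fin n) : FaceSmooth J fun q => (sqrtLift q i)⁻¹ := by
  intro q hq
  by_cases hi : i ∈ J
  · exact (faceSmooth_sqrtLift i q hq).inv (by simpa using (sqrtLift_pos hq hi).ne')
  · have h1 : (fun v : faceTangent J => (sqrtLift (q + (v : Fin n → ℝ)) i)⁻¹) = fun _ => 0 := by
      funext v
      simp [sqrtLift, hq.2.1 i hi, v.2.1 i hi]
    rw [h1]
    exact contDiffAt_const

/-! ### The preference form and its exact part -/

theorem faceDeriv_sqrtLift (hq : q ∈ openFace J) (v : faceTangent J) (i : Fin n) :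
    faceDeriv J sqrtLift q v i = (2 * sqrtLift q i)⁻¹ * (v : Fin n → ℝ) i := by
  have h : HasFDerivAt (fun v : faceTangent J => sqrtLift (q + (v : Fin n → ℝ)))
      (ContinuousLinearMap.pi fun i => (2 * sqrtLift q i)⁻¹ • tangentCoord J i) 0 :=
    hasFDerivAt_pi.2 fun i => hasFDerivAt_sqrtLift hq i
  rw [faceDeriv, h.fderiv]
  simp

/-- The image of `d√q` is orthogonal to `√q`, since `√q` stays on the unit sphere. -/
theorem sum_sqrtLift_mul_faceDeriv (hq : q ∈ openFace J) (v : faceTangent J) :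
    ∑ i, sqrtLift q i * faceDeriv J sqrtLift q v i = 0 := by
  have h : ∀ i, sqrtLift q i * faceDeriv J sqrtLift q v i = 2⁻¹ * (v : Fin n → ℝ) i := by
    intro i
    rw [faceDeriv_sqrtLift hq]
    by_cases hi : i ∈ J
    · have := (sqrtLift_pos hq hi).ne'
      field_simp
    · simp [v.2.1 i hi]
  simp only [h, ← Finset.mul_sum, v.2.2, mul_zero]

/-- The projector `I - ρρᵀ` drops out of the pullback, since `d√q` takes values in its range. -/
theorem prefForm_eq (A : Matrix (Fin n) (Fin n) ℝ) (hq : q ∈ openFace J) :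
    prefForm J A q =
      ∑ i, ((A *ᵥ sqrtLift q) i * (2 * sqrtLift q i)⁻¹) • tangentCoord J i := by
  ext v
  have h : ∀ i, (tangentProj (sqrtLift q) *ᵥ (A *ᵥ sqrtLift q)) i =
      (A *ᵥ sqrtLift q) i - (sqrtLift q ⬝ᵥ (A *ᵥ sqrtLift q)) * sqrtLift q i := by
    intro i
    rw [tangentProj, Matrix.sub_mulVec, Matrix.one_mulVec, Matrix.vecMulVec_mulVec]
    simp
  have h' : prefForm J A q v = ∑ i, ((A *ᵥ sqrtLift q) i -
      (sqrtLift q ⬝ᵥ (A *ᵥ sqrtLift q)) * sqrtLift q i) * faceDeriv J sqrtLift q v i := by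
    simp [prefForm, sphereForm, h]
  rw [h']
  simp only [sub_mul, Finset.sum_sub_distrib, mul_assoc, ← Finset.mul_sum,
    sum_sqrtLift_mul_faceDeriv hq, mul_zero, sub_zero]
  simp [faceDeriv_sqrtLift hq, mul_assoc]

theorem faceSmooth_mulVec_sqrtLift (A : Matrix (Fin n) (Fin n) ℝ) (i : Fin n) :
    FaceSmooth J fun q => (A *ᵥ sqrtLift q) i :=
  FaceSmooth.sum (t := Finset.univ) (f := fun j q => A i j * sqrtLift q j) fun j _ =>
    (faceSmooth_const _).mul (faceSmooth_sqrtLift j)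

theorem faceSmooth_prefForm (A : Matrix (Fin n) (Fin n) ℝ) : FaceSmooth J (prefForm J A) := by
  refine FaceSmooth.congr ?_ fun q hq => prefForm_eq A hq
  simp only [mul_inv]
  exact FaceSmooth.sum fun i _ => ((faceSmooth_mulVec_sqrtLift A i).mul
    ((faceSmooth_const _).mul (faceSmooth_inv_sqrtLift i))).smul_const _

theorem prefForm_add (A B : Matrix (Fin n) (Fin n) ℝ) (q : Fin n → ℝ) :
    prefForm J (A + B) q = prefForm J A q + prefForm J B q := by
  simp [prefForm, sphereForm, Matrix.add_mulVec, Matrix.mulVec_add, add_smul,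
    Finset.sum_add_distrib, ContinuousLinearMap.add_comp]

theorem faceSmooth_utility (S : Matrix (Fin n) (Fin n) ℝ) : FaceSmooth J (utility S) :=
  (faceSmooth_const _).mul <| FaceSmooth.sum (t := Finset.univ)
    (f := fun i q => sqrtLift q i * (S *ᵥ sqrtLift q) i) fun i _ =>
    (faceSmooth_sqrtLift i).mul (faceSmooth_mulVec_sqrtLift S i)

theorem hasFDerivAt_mulVec_sqrtLift (A : Matrix (Fin n) (Fin n) ℝ) (hq : q ∈ openFace J)
    (i : Fin n) :
    HasFDerivAt (fun v : faceTangent J => (A *ᵥ sqrtLift (q + (v : Fin n → ℝ))) i)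
      (∑ j, A i j • (2 * sqrtLift q j)⁻¹ • tangentCoord J j) 0 := by
  simp only [Matrix.mulVec, dotProduct]
  exact HasFDerivAt.fun_sum fun j _ => (hasFDerivAt_sqrtLift hq j).const_mul (A i j)

theorem prefForm_eq_faceDeriv_utility {S : Matrix (Fin n) (Fin n) ℝ} (hS : Sᵀ = S)
    (hq : q ∈ openFace J) : prefForm J S q = faceDeriv J (utility S) q := by
  have h : HasFDerivAt (fun v : faceTangent J => utility S (q + (v : Fin n → ℝ))) _ 0 :=
    (HasFDerivAt.fun_sum (u := Finset.univ) fun i _ =>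
      (hasFDerivAt_sqrtLift hq i).mul (hasFDerivAt_mulVec_sqrtLift S hq i)).const_mul (1 / 2)
  rw [prefForm_eq S hq, faceDeriv, h.fderiv]
  ext v
  have hsym : ∀ i j, S i j = S j i := fun i j => congrFun (congrFun hS j) i
  simp only [sum_apply, smul_apply,
    add_apply, tangentCoord_apply, smul_eq_mul, Submodule.coe_zero, add_zero,
    Finset.sum_add_distrib]
  have hswap : ∑ i, sqrtLift q i * ∑ j, S i j * ((2 * sqrtLift q j)⁻¹ * (v : Fin n → ℝ) j) =
      ∑ i, (S *ᵥ sqrtLift q) i * ((2 * sqrtLift q i)⁻¹ * (v : Fin n → ℝ) i) := by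
    simp only [Matrix.mulVec, dotProduct, Finset.mul_sum, Finset.sum_mul]
    rw [Finset.sum_comm]
    refine Finset.sum_congr rfl fun i _ => Finset.sum_congr rfl fun j _ => ?_
    rw [hsym i j]
    ring
  rw [hswap, ← two_mul]
  simp [mul_assoc]

/-! ### Algebra of the raised co-utility form -/

/-- The components `c (s_i s_j F_{ij} - s_i (F s)_i s_j² + s_i² s_j (F s)_j)`, with `s = √q`, of the
raised co-utility `2`-form. -/
def raisedComp (c : ℝ) (F : Matrix (Fin n) (Fin n) ℝ) (s : Fin n → ℝ) (i j : Fin n) : ℝ :=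
  c * (s i * s j * F i j - s i * (F *ᵥ s) i * s j ^ 2 + s i ^ 2 * (s j * (F *ᵥ s) j))

/-- The derivative of `raisedComp` in the direction `t` of the variable `s`. -/
def raisedCompDeriv (c : ℝ) (F : Matrix (Fin n) (Fin n) ℝ) (s t : Fin n → ℝ) (i j : Fin n) : ℝ :=
  c * ((t i * s j + s i * t j) * F i j
    - (t i * (F *ᵥ s) i * s j ^ 2 + s i * (F *ᵥ t) i * s j ^ 2
        + s i * (F *ᵥ s) i * (2 * s j * t j))
    + (2 * s i * t i * (s j * (F *ᵥ s) j)
        + s i ^ 2 * (t j * (F *ᵥ s) j + s j * (F *ᵥ t) j)))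

theorem sum_mul_mulVec_swap {F : Matrix (Fin n) (Fin n) ℝ} (hF : Fᵀ = -F) (s t : Fin n → ℝ) :
    ∑ i, s i * (F *ᵥ t) i = -∑ i, t i * (F *ᵥ s) i := by
  have h : s ⬝ᵥ (F *ᵥ t) = -(t ⬝ᵥ (F *ᵥ s)) := by
    rw [Matrix.dotProduct_mulVec, ← Matrix.mulVec_transpose, hF, Matrix.neg_mulVec,
      neg_dotProduct, dotProduct_comm]
  exact h

theorem sum_mul_mulVec_self {F : Matrix (Fin n) (Fin n) ℝ} (hF : Fᵀ = -F) (s : Fin n → ℝ) :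
    ∑ i, s i * (F *ᵥ s) i = 0 := by
  have := sum_mul_mulVec_swap hF s s
  linarith

theorem sum_mul_antisymm {F : Matrix (Fin n) (Fin n) ℝ} (hF : Fᵀ = -F) (s : Fin n → ℝ)
    (j : Fin n) : ∑ i, s i * F i j = -(F *ᵥ s) j := by
  have h : ∀ i, F i j = -F j i := fun i => congrFun (congrFun hF j) i
  simp only [h, Matrix.mulVec, dotProduct, mul_neg, Finset.sum_neg_distrib]
  exact congrArg _ (Finset.sum_congr rfl fun i _ => mul_comm _ _)

theorem sum_raisedComp {F : Matrix (Fin n) (Fin n) ℝ} (hF : Fᵀ = -F) (c : ℝ) {s : Fin n → ℝ}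
    (hs : ∑ i, s i ^ 2 = 1) (j : Fin n) : ∑ i, raisedComp c F s i j = 0 := by
  have h : ∀ i, raisedComp c F s i j = c * s j * (s i * F i j) - c * s j ^ 2 * (s i * (F *ᵥ s) i)
      + c * (s j * (F *ᵥ s) j) * s i ^ 2 := fun i => by unfold raisedComp; ring
  simp only [h, Finset.sum_add_distrib, Finset.sum_sub_distrib, ← Finset.mul_sum,
    sum_mul_antisymm hF, sum_mul_mulVec_self hF, hs]
  ring

/-- The column sums of `raisedComp` are `c (|s|² - 1) s_j (F s)_j`, whose derivative on the unit sphere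
only sees the factor `|s|² - 1`. -/
theorem sum_raisedCompDeriv {F : Matrix (Fin n) (Fin n) ℝ} (hF : Fᵀ = -F) (c : ℝ)
    {s : Fin n → ℝ} (hs : ∑ i, s i ^ 2 = 1) (t : Fin n → ℝ) (j : Fin n) :
    ∑ i, raisedCompDeriv c F s t i j = 2 * (∑ i, s i * t i) * (c * (s j * (F *ᵥ s) j)) := by
  have h : ∀ i, raisedCompDeriv c F s t i j =
      c * s j * (t i * F i j) + c * t j * (s i * F i j) - c * s j ^ 2 * (t i * (F *ᵥ s) i)
      - c * s j ^ 2 * (s i * (F *ᵥ t) i) - 2 * c * s j * t j * (s i * (F *ᵥ s) i)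
      + 2 * c * (s j * (F *ᵥ s) j) * (s i * t i)
      + c * (t j * (F *ᵥ s) j + s j * (F *ᵥ t) j) * s i ^ 2 := fun i => by
    unfold raisedCompDeriv; ring
  simp only [h, Finset.sum_add_distrib, Finset.sum_sub_distrib, ← Finset.mul_sum,
    sum_mul_antisymm hF, sum_mul_mulVec_self hF, hs, sum_mul_mulVec_swap hF s t]
  ring

/-- The coordinate divergence of the `j`-th column of the raised `2`-form, weighted by the density
`∏ s_i⁻¹`, over all ambient directions of the support. -/
theorem sum_weighted_raisedCompDeriv {F : Matrix (Fin n) (Fin n) ℝ} (hF : Fᵀ = -F) (c : ℝ)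
    {s : Fin n → ℝ} (hpos : ∀ i ∈ J, 0 < s i) (hzero : ∀ i ∉ J, s i = 0) {j : Fin n} (hj : j ∈ J) :
    ∑ i ∈ J, (raisedCompDeriv c F s (Pi.single i (2 * s i)⁻¹) i j
      - (2 * s i ^ 2)⁻¹ * raisedComp c F s i j) =
      J.card / 2 * (c * (s j * (F *ᵥ s) j)) := by
  have hdiag : ∀ i, F i i = 0 := fun i => by
    have : F i i = -F i i := congrFun (congrFun hF i) i
    linarith
  have hanti : ∀ i, F j i = -F i j := fun i => congrFun (congrFun hF i) j
  have h : ∀ i ∈ J, raisedCompDeriv c F s (Pi.single i (2 * s i)⁻¹) i j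
      - (2 * s i ^ 2)⁻¹ * raisedComp c F s i j =
      (if i = j then -(c * (s j * (F *ᵥ s) j)) / 2 else 0) - c * s j / 2 * (s i * F i j)
        + c * (s j * (F *ᵥ s) j) / 2 := by
    intro i hi
    have hsi := (hpos i hi).ne'
    unfold raisedCompDeriv raisedComp
    simp only [Matrix.mulVec_single, Pi.smul_apply, op_smul_eq_smul, smul_eq_mul,
      Matrix.col_apply, hdiag, Pi.single_eq_same, Pi.single_apply, hanti i, eq_comm (a := j)]
    split_ifs with hij
    · subst hij
      simp only [hdiag]
      field_simp
      ring
    · field_simp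
      ring
  have hsum : ∑ i ∈ J, s i * F i j = -(F *ᵥ s) j := by
    rw [← sum_mul_antisymm hF]
    exact Finset.sum_subset (Finset.subset_univ _) fun i _ hi => by simp [hzero i hi]
  rw [Finset.sum_congr rfl h]
  simp only [Finset.sum_add_distrib, Finset.sum_sub_distrib, ← Finset.mul_sum, hsum,
    Finset.sum_ite_eq', hj, if_true, Finset.sum_const, nsmul_eq_mul]
  ring

/-! ### Linear coordinates on a face -/

/-- The tangent vector `e_a - e_o`, for `o` and `a` in the support. -/
def diffVec {o : Fin n} (ho : o ∈ J) {a : Fin n} (ha : a ∈ J) : faceTangent J :=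
  ⟨Pi.single a 1 - Pi.single o 1, by
    refine ⟨fun i hi => ?_, by simp⟩
    have h1 : i ≠ a := fun h => hi (h ▸ ha)
    have h2 : i ≠ o := fun h => hi (h ▸ ho)
    simp [h1, h2]⟩

theorem sum_smul_diffVec {o : Fin n} (ho : o ∈ J) (v : faceTangent J) :
    ∑ k : {k // k ∈ J.erase o}, (v : Fin n → ℝ) k • diffVec ho (Finset.mem_of_mem_erase k.2) =
      v := by
  ext i
  have h : ∑ k ∈ J.erase o, (v : Fin n → ℝ) k = -(v : Fin n → ℝ) o := by
    have h1 : ∑ k ∈ J, (v : Fin n → ℝ) k = 0 := by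
      rw [← v.2.2]
      exact Finset.sum_subset (Finset.subset_univ _) fun k _ hk => v.2.1 k hk
    rw [← Finset.add_sum_erase J _ ho] at h1
    linarith
  have h2 : ∑ k : {k // k ∈ J.erase o}, (v : Fin n → ℝ) k *
      ((Pi.single (k : Fin n) 1 - Pi.single o 1 : Fin n → ℝ) i) =
      ∑ k ∈ J.erase o, (v : Fin n → ℝ) k * ((Pi.single k 1 - Pi.single o 1 : Fin n → ℝ) i) :=
    Finset.sum_coe_sort (J.erase o) fun k =>
      (v : Fin n → ℝ) k * ((Pi.single k 1 - Pi.single o 1 : Fin n → ℝ) i)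
  simp only [diffVec, AddSubmonoidClass.coe_finsetSum, Submodule.coe_smul, Finset.sum_apply,
    Pi.smul_apply, smul_eq_mul]
  rw [h2]
  simp only [Pi.sub_apply, mul_sub, Finset.sum_sub_distrib, ← Finset.sum_mul, h]
  simp only [Pi.single_apply, mul_ite, mul_one, mul_zero, Finset.sum_ite_eq, Finset.mem_erase]
  by_cases hio : i = o
  · simp [hio]
  · by_cases hi : i ∈ J
    · simp [hio, hi]
    · simp [hio, hi, v.2.1 i hi]

theorem linearIndependent_diffVec {o : Fin n} (ho : o ∈ J) :
    LinearIndependent ℝ fun k : {k // k ∈ J.erase o} =>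
      diffVec ho (Finset.mem_of_mem_erase k.2) := by
  rw [Fintype.linearIndependent_iff]
  intro g hg k
  have hk := congrFun (congrArg Subtype.val hg) (k : Fin n)
  have hko : (k : Fin n) ≠ o := Finset.ne_of_mem_erase k.2
  simpa [diffVec, hko, Pi.single_apply, Subtype.coe_inj] using hk

/-- A basis of the tangent space consisting of the vectors `e_a - e_o`, with the index type for
which `codifferential` is defined. -/
theorem exists_basis_diffVec {o : Fin n} (ho : o ∈ J) :
    ∃ (b : Module.Basis (Fin (Module.finrank ℝ (faceTangent J))) ℝ (faceTangent J))
      (c : Fin (Module.finrank ℝ (faceTangent J)) ≃ {k // k ∈ J.erase o}),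
      ∀ k, (b k : Fin n → ℝ) = Pi.single (c k : Fin n) 1 - Pi.single o 1 := by
  let b₀ : Module.Basis {k // k ∈ J.erase o} ℝ (faceTangent J) :=
    Module.Basis.mk (linearIndependent_diffVec ho) fun v _ => by
      rw [← sum_smul_diffVec ho v]
      exact Submodule.sum_mem _ fun k _ =>
        Submodule.smul_mem _ _ (Submodule.subset_span ⟨k, rfl⟩)
  let e : {k // k ∈ J.erase o} ≃ Fin (Module.finrank ℝ (faceTangent J)) :=
    Fintype.equivFinOfCardEq (Module.finrank_eq_card_basis b₀).symm
  refine ⟨b₀.reindex e, e.symm, fun k => ?_⟩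
  simp [b₀, diffVec]

theorem sum_openFace (hq : q ∈ openFace J) : ∑ a ∈ J, q a = 1 := by
  rw [← hq.2.2]
  exact Finset.sum_subset (Finset.subset_univ _) fun k _ hk => hq.2.1 k hk

section Coordinates

variable {κ : Type*} {o : Fin n}
  {b : Module.Basis κ ℝ (faceTangent J)} {c : κ ≃ {k // k ∈ J.erase o}}

theorem coord_ne (c : κ ≃ {k // k ∈ J.erase o}) (k : κ) : (c k : Fin n) ≠ o :=
  Finset.ne_of_mem_erase (c k).2

theorem coord_mem (c : κ ≃ {k // k ∈ J.erase o}) (k : κ) : (c k : Fin n) ∈ J :=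
  Finset.mem_of_mem_erase (c k).2

theorem fisherRao_basis (ho : o ∈ J)
    (hb : ∀ k, (b k : Fin n → ℝ) = Pi.single (c k : Fin n) 1 - Pi.single o 1) (q : Fin n → ℝ)
    (k : κ) (v : faceTangent J) :
    fisherRao J q (b k) v = (v : Fin n → ℝ) (c k) / q (c k) - (v : Fin n → ℝ) o / q o := by
  simp only [fisherRao, LinearMap.mk₂_apply, hb, Pi.sub_apply, Pi.single_apply, sub_mul, sub_div,
    Finset.sum_sub_distrib, ite_mul, one_mul, zero_mul, ite_div, zero_div, Finset.sum_ite_eq', ho,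
    coord_mem, if_true]

section

variable [Fintype κ]

theorem sum_coord (c : κ ≃ {k // k ∈ J.erase o}) (f : Fin n → ℝ) :
    ∑ k, f (c k) = ∑ a ∈ J.erase o, f a :=
  (c.sum_comp fun a => f a).trans (Finset.sum_coe_sort (J.erase o) f)

theorem sum_coord_openFace (ho : o ∈ J) (c : κ ≃ {k // k ∈ J.erase o}) (hq : q ∈ openFace J) :
    ∑ k, q (c k) = 1 - q o := by
  rw [sum_coord c, ← sum_openFace hq, ← Finset.add_sum_erase J q ho]
  ring

end

variable [DecidableEq κ]

theorem gram_fisherRao (ho : o ∈ J)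
    (hb : ∀ k, (b k : Fin n → ℝ) = Pi.single (c k : Fin n) 1 - Pi.single o 1) (q : Fin n → ℝ) :
    gram b (fisherRao J) q =
      Matrix.of fun k l => (if k = l then (q (c k))⁻¹ else 0) + (q o)⁻¹ := by
  ext k l
  have h1 : ∀ k, o ≠ (c k : Fin n) := fun k => (coord_ne c k).symm
  rw [gram, Matrix.of_apply, fisherRao_basis ho hb, hb]
  by_cases hkl : k = l
  · simp [hkl, h1, coord_ne, neg_div]
  · have : (c k : Fin n) ≠ c l := fun h => hkl (c.injective (Subtype.ext h))
    simp [hkl, this, h1, coord_ne, neg_div]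

variable [Fintype κ]

theorem det_gram_fisherRao (ho : o ∈ J)
    (hb : ∀ k, (b k : Fin n → ℝ) = Pi.single (c k : Fin n) 1 - Pi.single o 1)
    (hq : q ∈ openFace J) : (gram b (fisherRao J) q).det = ∏ a ∈ J, (q a)⁻¹ := by
  have hne : ∀ k, q (c k) ≠ 0 := fun k => (hq.1 _ (coord_mem c k)).ne'
  have hfac : gram b (fisherRao J) q = Matrix.diagonal (fun k => (q (c k))⁻¹) *
      (1 + Matrix.replicateCol Unit (fun k => q (c k)) *
        Matrix.replicateRow Unit (fun _ : κ => (q o)⁻¹)) := by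
    rw [gram_fisherRao ho hb]
    ext k l
    rw [Matrix.diagonal_mul]
    simp only [Matrix.of_apply, Matrix.add_apply, Matrix.one_apply,
      Matrix.mul_apply, Finset.univ_unique, Finset.sum_singleton, Matrix.replicateCol_apply,
      Matrix.replicateRow_apply, mul_add, mul_ite, mul_one, mul_zero]
    rw [inv_mul_cancel_left₀ (hne k)]
  have hprod : ∏ k, (q (c k))⁻¹ = ∏ a ∈ J.erase o, (q a)⁻¹ :=
    (c.prod_comp fun a => (q a)⁻¹).trans (Finset.prod_coe_sort (J.erase o) fun a => (q a)⁻¹)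
  rw [hfac, Matrix.det_mul, Matrix.det_diagonal, Matrix.det_one_add_replicateCol_mul_replicateRow,
    dotProduct, ← Finset.mul_sum, sum_coord_openFace ho c hq, hprod,
    ← Finset.mul_prod_erase J _ ho]
  have := (hq.1 o ho).ne'
  field_simp
  ring

theorem gram_fisherRao_inv (ho : o ∈ J)
    (hb : ∀ k, (b k : Fin n → ℝ) = Pi.single (c k : Fin n) 1 - Pi.single o 1)
    (hq : q ∈ openFace J) : (gram b (fisherRao J) q)⁻¹ =
      Matrix.of fun k l => (if k = l then q (c k) else 0) - q (c k) * q (c l) := by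
  refine Matrix.inv_eq_right_inv ?_
  have hne : ∀ k, q (c k) ≠ 0 := fun k => (hq.1 _ (coord_mem c k)).ne'
  have hno := (hq.1 o ho).ne'
  rw [gram_fisherRao ho hb]
  ext k m
  simp only [Matrix.mul_apply, Matrix.of_apply, add_mul, mul_sub, Finset.sum_add_distrib,
    Finset.sum_sub_distrib, ite_mul, mul_ite, zero_mul, mul_zero, Finset.sum_ite_eq,
    Finset.sum_ite_eq', Finset.mem_univ, if_true, ← Finset.mul_sum, ← Finset.sum_mul,
    sum_coord_openFace ho c hq, Matrix.one_apply]
  have h := hne k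
  split_ifs with hkm
  · subst hkm
    field_simp
    ring
  · field_simp
    ring

/-- The `k`-th row of `g⁻¹`, as a tangent vector, is `q_a (e_a - q)` with `a = c k`: the gradient
of the coordinate function `q_a`. -/
theorem gram_fisherRao_inv_mul_basis (ho : o ∈ J)
    (hb : ∀ k, (b k : Fin n → ℝ) = Pi.single (c k : Fin n) 1 - Pi.single o 1)
    (hq : q ∈ openFace J) : (gram b (fisherRao J) q)⁻¹ * (Matrix.of fun k => (b k : Fin n → ℝ)) =
      Matrix.of fun k (a : Fin n) => (if a = c k then q (c k) else 0) - q (c k) * q a := by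
  rw [gram_fisherRao_inv ho hb hq]
  ext k a
  have hsum : ∑ l, q (c l) * ((b l : Fin n → ℝ) a) = q a - if a = o then 1 else 0 := by
    have h1 : ∑ l, q (c l) * ((b l : Fin n → ℝ) a) =
        ∑ i ∈ J.erase o, q i * ((Pi.single i 1 - Pi.single o 1 : Fin n → ℝ) a) :=
      (Finset.sum_congr rfl fun l _ => by rw [hb]).trans
        (sum_coord c fun i => q i * ((Pi.single i 1 - Pi.single o 1 : Fin n → ℝ) a))
    rw [h1]
    simp only [Pi.sub_apply, mul_sub, Finset.sum_sub_distrib, ← Finset.sum_mul, ← sum_coord c q,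
      sum_coord_openFace ho c hq]
    simp only [Pi.single_apply, mul_ite, mul_one, mul_zero, Finset.sum_ite_eq, Finset.mem_erase]
    by_cases hao : a = o
    · subst hao; simp
    · by_cases ha : a ∈ J
      · simp [hao, ha]
      · simp [hao, ha, hq.2.1 a ha]
  have hexp : ∀ l, ((if k = l then q (c k) else 0) - q (c k) * q (c l)) * (b l : Fin n → ℝ) a =
      (if k = l then q (c k) * (b l : Fin n → ℝ) a else 0) -
        q (c k) * (q (c l) * (b l : Fin n → ℝ) a) := fun l => by
    split_ifs <;> ring
  simp only [Matrix.mul_apply, Matrix.of_apply, hexp, Finset.sum_sub_distrib, ← Finset.mul_sum,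
    hsum, Finset.sum_ite_eq, Finset.mem_univ, if_true]
  rw [hb]
  simp only [Pi.sub_apply, Pi.single_apply]
  split_ifs <;> ring

end Coordinates

/-! ### The co-utility two-form and its codifferential -/

/-- The constant `2`-form `dq_a ∧ dq_b` on a face. -/
def coordWedge (J : Finset (Fin n)) (a b : Fin n) : faceTangent J [⋀^Fin 2]→L[ℝ] ℝ :=
  ContinuousMultilinearMap.alternatization
    ((ContinuousMultilinearMap.mkPiAlgebra ℝ (Fin 2) ℝ).compContinuousLinearMap
      fun i => tangentCoord J (![a, b] i))

theorem coordWedge_apply (a b : Fin n) (v w : faceTangent J) :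
    coordWedge J a b ![v, w] =
      (v : Fin n → ℝ) a * (w : Fin n → ℝ) b - (v : Fin n → ℝ) b * (w : Fin n → ℝ) a := by
  have h := Matrix.det_apply (Matrix.of fun i j : Fin 2 =>
    ((![v, w] i : faceTangent J) : Fin n → ℝ) (![a, b] j))
  rw [Matrix.det_fin_two] at h
  rw [coordWedge, ContinuousMultilinearMap.alternatization_apply_apply]
  simpa using h.symm

/-- The `2`-form `c ∑ F_{ab} (√(q_a q_b))⁻¹ dq_a ⊗ dq_b`, a multiple of the pullback of the exterior
derivative of `(Fρ)ᵀ dρ`. The factor `2⁻¹` accounts for both orders of `a` and `b` in the sum.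
The sum runs over all indices: off `J` the coefficients vanish on the face, as `0⁻¹ = 0`. -/
def coutilityForm (J : Finset (Fin n)) (c : ℝ) (F : Matrix (Fin n) (Fin n) ℝ) : TwoForm J :=
  fun q => ∑ a, ∑ b,
    (c * 2⁻¹ * F a b * ((sqrtLift q a)⁻¹ * (sqrtLift q b)⁻¹)) • coordWedge J a b

theorem faceSmooth_coutilityForm (c : ℝ) (F : Matrix (Fin n) (Fin n) ℝ) :
    FaceSmooth J (coutilityForm J c F) :=
  FaceSmooth.sum fun a _ => FaceSmooth.sum fun b _ => FaceSmooth.smul_const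
    ((faceSmooth_const _).mul ((faceSmooth_inv_sqrtLift a).mul (faceSmooth_inv_sqrtLift b))) _

theorem coutilityForm_apply {F : Matrix (Fin n) (Fin n) ℝ} (hF : Fᵀ = -F) (c : ℝ)
    (q : Fin n → ℝ) (v w : faceTangent J) :
    coutilityForm J c F q ![v, w] = ∑ a, ∑ b, (v : Fin n → ℝ) a *
      (c * F a b * ((sqrtLift q a)⁻¹ * (sqrtLift q b)⁻¹)) * (w : Fin n → ℝ) b := by
  have hanti : ∀ i j, F i j = -F j i := fun i j => congrFun (congrFun hF j) i
  have h1 : coutilityForm J c F q ![v, w] =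
      ∑ a, ∑ b, (c * 2⁻¹ * F a b * ((sqrtLift q a)⁻¹ * (sqrtLift q b)⁻¹)) *
        ((v : Fin n → ℝ) a * (w : Fin n → ℝ) b) -
      ∑ a, ∑ b, (c * 2⁻¹ * F a b * ((sqrtLift q a)⁻¹ * (sqrtLift q b)⁻¹)) *
        ((v : Fin n → ℝ) b * (w : Fin n → ℝ) a) := by
    simp only [coutilityForm, ContinuousAlternatingMap.sum_apply,
      ContinuousAlternatingMap.smul_apply, coordWedge_apply, smul_eq_mul, mul_sub,
      Finset.sum_sub_distrib]
  rw [h1, sub_eq_iff_eq_add,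
    Finset.sum_comm (f := fun a b => (c * 2⁻¹ * F a b * ((sqrtLift q a)⁻¹ * (sqrtLift q b)⁻¹)) *
        ((v : Fin n → ℝ) b * (w : Fin n → ℝ) a)), ← Finset.sum_add_distrib]
  refine Finset.sum_congr rfl fun a _ => ?_
  rw [← Finset.sum_add_distrib]
  refine Finset.sum_congr rfl fun b _ => ?_
  rw [hanti b a]
  ring

/-- The components of the raised `2`-form weighted by the Riemannian density `∏ (√q_a)⁻¹`. -/
def weightedRaisedComp (J : Finset (Fin n)) (c : ℝ) (F : Matrix (Fin n) (Fin n) ℝ)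
    (q : Fin n → ℝ) (i j : Fin n) : ℝ :=
  (∏ a ∈ J, (sqrtLift q a)⁻¹) * raisedComp c F (sqrtLift q) i j

theorem hasFDerivAt_prod_inv_sqrtLift (hq : q ∈ openFace J) :
    HasFDerivAt (fun v : faceTangent J => ∏ a ∈ J, (sqrtLift (q + (v : Fin n → ℝ)) a)⁻¹)
      (-(∏ a ∈ J, (sqrtLift q a)⁻¹) • ∑ a ∈ J, (2 * sqrtLift q a ^ 2)⁻¹ • tangentCoord J a) 0 := by
  have h : ∀ a ∈ J, HasFDerivAt (fun v : faceTangent J => (sqrtLift (q + (v : Fin n → ℝ)) a)⁻¹)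
      (-(sqrtLift q a ^ 2)⁻¹ • (2 * sqrtLift q a)⁻¹ • tangentCoord J a) 0 := fun a ha => by
    have hd : HasDerivAt (fun y : ℝ => y⁻¹) (-(sqrtLift q a ^ 2)⁻¹)
        (sqrtLift (q + ((0 : faceTangent J) : Fin n → ℝ)) a) := by
      simpa using hasDerivAt_inv (sqrtLift_pos hq ha).ne'
    exact hd.comp_hasFDerivAt (0 : faceTangent J) (hasFDerivAt_sqrtLift hq a)
  refine (HasFDerivAt.finsetProd h).congr_fderiv ?_
  rw [Finset.smul_sum]
  refine Finset.sum_congr rfl fun a ha => ?_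
  rw [← Finset.mul_prod_erase J _ ha, smul_smul, smul_smul, smul_smul]
  congr 1
  have := (sqrtLift_pos hq ha).ne'
  simp only [Submodule.coe_zero, add_zero]
  field_simp

/-- The derivative is only needed through its values, `raisedCompDeriv` in the direction `d√q(u)`. -/
theorem hasFDerivAt_raisedComp (c : ℝ) (F : Matrix (Fin n) (Fin n) ℝ) (hq : q ∈ openFace J)
    (i j : Fin n) : ∃ D : faceTangent J →L[ℝ] ℝ,
    HasFDerivAt (fun v : faceTangent J => raisedComp c F (sqrtLift (q + (v : Fin n → ℝ))) i j)
      D 0 ∧ ∀ u : faceTangent J, D u = raisedCompDeriv c F (sqrtLift q)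
        (fun a => (2 * sqrtLift q a)⁻¹ * (u : Fin n → ℝ) a) i j := by
  have hi := hasFDerivAt_sqrtLift hq i
  have hj := hasFDerivAt_sqrtLift hq j
  have hFi := hasFDerivAt_mulVec_sqrtLift F hq i
  have hFj := hasFDerivAt_mulVec_sqrtLift F hq j
  refine ⟨_, ((((hi.mul hj).mul_const (F i j)).sub ((hi.mul hFi).mul (hj.pow 2))).add
    ((hi.pow 2).mul (hj.mul hFj))).const_mul c, fun u => ?_⟩
  have e : ∀ k, (∑ l, F k l • (2 * sqrtLift q l)⁻¹ • tangentCoord J l) u =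
      (F *ᵥ fun a => (2 * sqrtLift q a)⁻¹ * (u : Fin n → ℝ) a) k := fun k => by
    simp [Matrix.mulVec, dotProduct]
  simp only [raisedCompDeriv, smul_apply, add_apply, sub_apply, e, tangentCoord_apply,
    smul_eq_mul, Submodule.coe_zero, add_zero, Pi.mul_apply]
  generalize (F *ᵥ fun a => (2 * sqrtLift q a)⁻¹ * (u : Fin n → ℝ) a) = t
  simp only [nsmul_eq_mul, Nat.cast_ofNat, Nat.add_one_sub_one, pow_one]
  ring

theorem hasFDerivAt_weightedRaisedComp (c : ℝ) (F : Matrix (Fin n) (Fin n) ℝ)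
    (hq : q ∈ openFace J) (i j : Fin n) : ∃ D : faceTangent J →L[ℝ] ℝ,
    HasFDerivAt (fun v : faceTangent J => weightedRaisedComp J c F (q + (v : Fin n → ℝ)) i j) D 0 ∧
    ∀ u : faceTangent J, D u = (∏ a ∈ J, (sqrtLift q a)⁻¹) *
      (raisedCompDeriv c F (sqrtLift q)
          (fun a => (2 * sqrtLift q a)⁻¹ * (u : Fin n → ℝ) a) i j -
        (∑ a ∈ J, (2 * sqrtLift q a ^ 2)⁻¹ * (u : Fin n → ℝ) a) *
          raisedComp c F (sqrtLift q) i j) := by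
  obtain ⟨D, hD, hDu⟩ := hasFDerivAt_raisedComp c F hq i j
  refine ⟨_, (hasFDerivAt_prod_inv_sqrtLift hq).mul hD, fun u => ?_⟩
  simp only [add_apply, smul_apply, sum_apply, hDu, tangentCoord_apply, smul_eq_mul,
    Submodule.coe_zero, add_zero]
  ring

section Coordinates

variable {κ : Type*} [Fintype κ] [DecidableEq κ] {o : Fin n}
  {b : Module.Basis κ ℝ (faceTangent J)} {k : κ ≃ {a // a ∈ J.erase o}}

theorem raised_coutilityForm {F : Matrix (Fin n) (Fin n) ℝ} (hF : Fᵀ = -F) (c : ℝ) (ho : o ∈ J)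
    (hb : ∀ i, (b i : Fin n → ℝ) = Pi.single (k i : Fin n) 1 - Pi.single o 1)
    (hq : q ∈ openFace J) (i j : κ) :
    raised b (fisherRao J) (coutilityForm J c F) q i j =
      raisedComp c F (sqrtLift q) (k i) (k j) := by
  set s := sqrtLift q with hs
  set B : Matrix κ (Fin n) ℝ := Matrix.of fun i => (b i : Fin n → ℝ) with hB
  set M : Matrix (Fin n) (Fin n) ℝ := Matrix.of fun a b => c * F a b * ((s a)⁻¹ * (s b)⁻¹) with hM
  have hcomps : comps b (coutilityForm J c F) q = B * M * Bᵀ := by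
    ext i j
    simp only [comps, Matrix.of_apply, coutilityForm_apply hF, Matrix.mul_apply, hB, hM,
      Matrix.transpose_apply, Finset.sum_mul]
    exact Finset.sum_comm
  have hraised : raised b (fisherRao J) (coutilityForm J c F) q =
      ((gram b (fisherRao J) q)⁻¹ * B) * M * ((gram b (fisherRao J) q)⁻¹ * B)ᵀ := by
    rw [raised, hcomps, Matrix.transpose_mul]
    simp only [Matrix.mul_assoc]
  have hsq : ∀ a, q a * (s a)⁻¹ = s a := fun a => by
    rw [← sqrtLift_sq hq a, ← hs]
    by_cases h : s a = 0
    · simp [h]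
    · field_simp
  have hMr : ∀ a, ∑ b, M a b * q b = c * (s a)⁻¹ * (F *ᵥ s) a := fun a => by
    simp only [hM, Matrix.of_apply, Matrix.mulVec, dotProduct, Finset.mul_sum]
    refine Finset.sum_congr rfl fun b _ => ?_
    linear_combination c * F a b * (s a)⁻¹ * hsq b
  have hMl : ∀ b, ∑ a, q a * M a b = -(c * (s b)⁻¹ * (F *ᵥ s) b) := fun b => by
    have h : ∀ a, q a * M a b = c * (s b)⁻¹ * (s a * F a b) := fun a => by
      rw [hM, Matrix.of_apply]
      linear_combination c * F a b * (s b)⁻¹ * hsq a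
    simp only [h, ← Finset.mul_sum, sum_mul_antisymm hF]
    ring
  have hMM : ∑ b, (∑ a, q a * M a b) * q b = 0 := by
    have h : ∀ b, (∑ a, q a * M a b) * q b = -c * (s b * (F *ᵥ s) b) := fun b => by
      rw [hMl]
      linear_combination -(c * (F *ᵥ s) b) * hsq b
    simp only [h, ← Finset.mul_sum, sum_mul_mulVec_self hF, mul_zero]
  rw [hraised, hB, gram_fisherRao_inv_mul_basis ho hb hq]
  simp only [Matrix.mul_apply, Matrix.of_apply, Matrix.transpose_apply, sub_mul, mul_sub, ite_mul,
    mul_ite, zero_mul, mul_zero, Finset.sum_sub_distrib, Finset.sum_ite_eq', Finset.mem_univ,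
    if_true]
  have e1 : ∑ x, q (k i) * M (k i) x * (q (k j) * q x) =
      q (k i) * q (k j) * ∑ x, M (k i) x * q x := by
    rw [Finset.mul_sum]
    exact Finset.sum_congr rfl fun x _ => by ring
  have e2 : ∀ x, ∑ a, q (k i) * q a * M a x = q (k i) * ∑ a, q a * M a x := fun x => by
    rw [Finset.mul_sum]
    exact Finset.sum_congr rfl fun a _ => by ring
  have e3 : ∑ x, (q (k i) * ∑ a, q a * M a x) * (q (k j) * q x) =
      q (k i) * q (k j) * ∑ x, (∑ a, q a * M a x) * q x := by
    rw [Finset.mul_sum]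
    exact Finset.sum_congr rfl fun x _ => by ring
  simp only [e2]
  rw [e1, e3, hMM]
  simp only [hMr, hMl]
  have hi := (sqrtLift_pos hq (coord_mem k i)).ne'
  have hj := (sqrtLift_pos hq (coord_mem k j)).ne'
  rw [← hs] at hi hj
  simp only [raisedComp, hM, Matrix.of_apply, ← sqrtLift_sq hq, ← hs]
  field_simp
  ring

theorem sqrt_det_gram_fisherRao (ho : o ∈ J)
    (hb : ∀ i, (b i : Fin n → ℝ) = Pi.single (k i : Fin n) 1 - Pi.single o 1)
    (hq : q ∈ openFace J) : √(gram b (fisherRao J) q).det = ∏ a ∈ J, (sqrtLift q a)⁻¹ := by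
  have h : ∏ a ∈ J, (q a)⁻¹ = (∏ a ∈ J, (sqrtLift q a)⁻¹) ^ 2 := by
    rw [← Finset.prod_pow]
    exact Finset.prod_congr rfl fun a _ => by rw [inv_pow, sqrtLift_sq hq]
  rw [det_gram_fisherRao ho hb hq, h, Real.sqrt_sq]
  exact Finset.prod_nonneg fun a _ => inv_nonneg.2 (Real.sqrt_nonneg _)

theorem sqrt_det_mul_raised_coutilityForm {F : Matrix (Fin n) (Fin n) ℝ} (hF : Fᵀ = -F) (c : ℝ)
    (ho : o ∈ J) (hb : ∀ i, (b i : Fin n → ℝ) = Pi.single (k i : Fin n) 1 - Pi.single o 1)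
    (hq : q ∈ openFace J) (i j : κ) :
    √(gram b (fisherRao J) q).det * raised b (fisherRao J) (coutilityForm J c F) q i j =
      weightedRaisedComp J c F q (k i) (k j) := by
  rw [raised_coutilityForm hF c ho hb hq, sqrt_det_gram_fisherRao ho hb hq, weightedRaisedComp]

/-- The sum of the coordinate derivatives in the directions `e_a - e_o`, for `a ∈ J`. -/
theorem sum_raisedCompDeriv_basis {F : Matrix (Fin n) (Fin n) ℝ} (hF : Fᵀ = -F) (c : ℝ)
    (ho : o ∈ J) {s : Fin n → ℝ} (hpos : ∀ i ∈ J, 0 < s i) (hzero : ∀ i ∉ J, s i = 0)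
    (hs : ∑ i, s i ^ 2 = 1) {j : Fin n} (hj : j ∈ J) :
    ∑ a ∈ J.erase o, (raisedCompDeriv c F s
        (fun d => (2 * s d)⁻¹ * (Pi.single a 1 - Pi.single o 1 : Fin n → ℝ) d) a j -
      ((2 * s a ^ 2)⁻¹ - (2 * s o ^ 2)⁻¹) * raisedComp c F s a j) =
      (J.card / 2 - 1) * (c * (s j * (F *ᵥ s) j)) := by
  set t : Fin n → Fin n → ℝ := fun a => Pi.single a (2 * s a)⁻¹ with ht
  have hdir : ∀ a, (fun d => (2 * s d)⁻¹ * (Pi.single a 1 - Pi.single o 1 : Fin n → ℝ) d) =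
      t a - t o := fun a => by
    funext d
    simp only [ht, Pi.sub_apply, Pi.single_apply]
    split_ifs <;> simp_all
  have hsub : ∀ a, raisedCompDeriv c F s (t a - t o) a j =
      raisedCompDeriv c F s (t a) a j - raisedCompDeriv c F s (t o) a j := fun a => by
    simp only [raisedCompDeriv, Matrix.mulVec_sub, Pi.sub_apply]
    ring
  have hterm : ∀ a, raisedCompDeriv c F s (t a - t o) a j -
      ((2 * s a ^ 2)⁻¹ - (2 * s o ^ 2)⁻¹) * raisedComp c F s a j =
      (raisedCompDeriv c F s (t a) a j - (2 * s a ^ 2)⁻¹ * raisedComp c F s a j) -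
        raisedCompDeriv c F s (t o) a j + (2 * s o ^ 2)⁻¹ * raisedComp c F s a j := fun a => by
    rw [hsub]
    ring
  simp only [hdir]
  -- The direction `e_o - e_o` vanishes, so the sum may be taken over all of `J`.
  rw [Finset.sum_erase _ (by simp [raisedCompDeriv])]
  simp only [hterm, Finset.sum_add_distrib (s := J)]
  rw [Finset.sum_sub_distrib, sum_weighted_raisedCompDeriv hF c hpos hzero hj, ← Finset.mul_sum]
  have h1 : ∑ a ∈ J, raisedComp c F s a j = 0 := by
    rw [← sum_raisedComp hF c hs j]
    exact Finset.sum_subset (Finset.subset_univ _) fun a _ ha => by simp [raisedComp, hzero a ha]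
  have h2 : ∑ a ∈ J, raisedCompDeriv c F s (t o) a j = c * (s j * (F *ᵥ s) j) := by
    have h3 : ∑ a, s a * t o a = 1 / 2 := by
      have := (hpos o ho).ne'
      simp only [ht, Pi.single_apply, mul_ite, mul_zero, Finset.sum_ite_eq', Finset.mem_univ,
        if_true]
      field_simp
    have h4 : ∑ a, raisedCompDeriv c F s (t o) a j = c * (s j * (F *ᵥ s) j) := by
      rw [sum_raisedCompDeriv hF c hs, h3]
      ring
    rw [← h4]
    refine Finset.sum_subset (Finset.subset_univ _) fun a _ ha => ?_
    have hao : a ≠ o := fun h => ha (h ▸ ho)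
    simp [raisedCompDeriv, hzero a ha, ht, hao]
  rw [h1, h2]
  ring

/-- For `c = -(|J| - 2)⁻¹`, the codifferential in the coordinates `e_a - e_o` is the preference form
of `F`; the factor `|J| - 2` is where supports of size two are excluded. -/
theorem codiffIn_coutilityForm {F : Matrix (Fin n) (Fin n) ℝ} (hF : Fᵀ = -F) {c : ℝ}
    (hc : c * (J.card - 2) = -1) (ho : o ∈ J)
    (hb : ∀ i, (b i : Fin n → ℝ) = Pi.single (k i : Fin n) 1 - Pi.single o 1)
    (hq : q ∈ openFace J) (v : faceTangent J) :
    codiffIn b (fisherRao J) (coutilityForm J c F) q v = prefForm J F q v := by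
  set s := sqrtLift q with hs
  have hpos : ∀ i ∈ J, 0 < s i := fun i hi => sqrtLift_pos hq hi
  have hzero : ∀ i ∉ J, s i = 0 := fun i hi => sqrtLift_eq_zero hq hi
  have hprod : ∏ a ∈ J, (s a)⁻¹ ≠ 0 := Finset.prod_ne_zero_iff.2 fun a ha =>
    inv_ne_zero (hpos a ha).ne'
  obtain ⟨f, hf⟩ : ∃ f : Fin n → Fin n → ℝ, ∀ a j, f a j = raisedCompDeriv c F s
      (fun d => (2 * s d)⁻¹ * (Pi.single a 1 - Pi.single o 1 : Fin n → ℝ) d) a j -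
        ((2 * s a ^ 2)⁻¹ - (2 * s o ^ 2)⁻¹) * raisedComp c F s a j := ⟨_, fun _ _ => rfl⟩
  have hder : ∀ i j, faceDeriv J (fun x => √(gram b (fisherRao J) x).det *
      raised b (fisherRao J) (coutilityForm J c F) x i j) q (b i) =
      (∏ a ∈ J, (s a)⁻¹) * f (k i) (k j) := by
    intro i j
    obtain ⟨D, hD, hDu⟩ := hasFDerivAt_weightedRaisedComp c F hq (k i) (k j)
    have hD' := hD.congr_of_eventuallyEq ((eventually_mem_openFace hq).mono fun w hw =>
      sqrt_det_mul_raised_coutilityForm hF c ho hb hw i j)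
    have hsum : ∑ a ∈ J, (2 * s a ^ 2)⁻¹ *
        (Pi.single (k i : Fin n) 1 - Pi.single o 1 : Fin n → ℝ) a =
        (2 * s (k i) ^ 2)⁻¹ - (2 * s o ^ 2)⁻¹ := by
      simp only [Pi.sub_apply, Pi.single_apply, mul_sub, mul_ite, mul_one, mul_zero,
        Finset.sum_sub_distrib, Finset.sum_ite_eq', coord_mem, ho, if_true]
    rw [faceDeriv, hD'.fderiv, hDu, hb, ← hs, hsum, hf]
  have hdiv : ∀ j, -((√(gram b (fisherRao J) q).det)⁻¹ * ∑ i, faceDeriv J (fun x =>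
      √(gram b (fisherRao J) x).det * raised b (fisherRao J) (coutilityForm J c F) x i j) q (b i)) =
      2⁻¹ * (s (k j) * (F *ᵥ s) (k j)) := by
    intro j
    have hsum : ∑ i, f (k i) (k j) = (J.card / 2 - 1) * (c * (s (k j) * (F *ᵥ s) (k j))) := by
      rw [sum_coord k fun a => f a (k j), Finset.sum_congr rfl fun a _ => hf a (k j)]
      exact sum_raisedCompDeriv_basis hF c ho hpos hzero (sum_sqrtLift_sq hq) (coord_mem k j)
    simp only [hder, ← Finset.mul_sum, hsum]
    rw [sqrt_det_gram_fisherRao ho hb hq, ← hs, inv_mul_cancel_left₀ hprod]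
    linear_combination -(s (k j) * (F *ᵥ s) (k j) / 2) * hc
  -- Lowering the index: `s_a (F s)_a` sums to zero over `J`, so the reference index `o` drops out.
  have hsF : ∑ a ∈ J, s a * (F *ᵥ s) a = 0 := by
    rw [← sum_mul_mulVec_self hF s]
    exact Finset.sum_subset (Finset.subset_univ _) fun a _ ha => by simp [hzero a ha]
  have hlow : codiffIn b (fisherRao J) (coutilityForm J c F) q v =
      ∑ j, 2⁻¹ * (s (k j) * (F *ᵥ s) (k j)) *
        ((v : Fin n → ℝ) (k j) / q (k j) - (v : Fin n → ℝ) o / q o) :=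
    Finset.sum_congr rfl fun j _ => by rw [hdiv, fisherRao_basis ho hb]
  rw [hlow, sum_coord k fun a => 2⁻¹ * (s a * (F *ᵥ s) a) *
      ((v : Fin n → ℝ) a / q a - (v : Fin n → ℝ) o / q o), Finset.sum_erase _ (by simp),
    prefForm_eq F hq]
  simp only [mul_sub, Finset.sum_sub_distrib, ← Finset.sum_mul, ← Finset.mul_sum, hsF, mul_zero,
    zero_mul, sub_zero, sum_apply, smul_apply, tangentCoord_apply, smul_eq_mul, ← hs]
  rw [← Finset.sum_subset (Finset.subset_univ J) fun a _ ha => by simp [hzero a ha]]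
  refine Finset.sum_congr rfl fun a ha => ?_
  have := (hpos a ha).ne'
  rw [← sqrtLift_sq hq a, ← hs]
  field_simp

end Coordinates

theorem codifferential_coutilityForm {F : Matrix (Fin n) (Fin n) ℝ} (hF : Fᵀ = -F) {c : ℝ}
    (hc : c * (J.card - 2) = -1) (hJ : J.Nonempty) (hq : q ∈ openFace J) (v : faceTangent J) :
    codifferential (fisherRao J) (coutilityForm J c F) q v = prefForm J F q v := by
  obtain ⟨o, ho⟩ := hJ
  obtain ⟨b, k, hb⟩ := exists_basis_diffVec ho
  rw [← codiffIn_coutilityForm hF hc ho hb hq v, codifferential]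
  refine codiffIn_eq b _ _ _ q (fun i j => ?_) v
  obtain ⟨D, hD, -⟩ := hasFDerivAt_weightedRaisedComp c F hq (k i) (k j)
  exact (hD.congr_of_eventuallyEq ((eventually_mem_openFace hq).mono fun w hw =>
    sqrt_det_mul_raised_coutilityForm hF c ho hb hw i j)).differentiableAt

theorem exists_eq_codifferential {F : Matrix (Fin n) (Fin n) ℝ} (hF : Fᵀ = -F)
    (hJ : 3 ≤ J.card) : ∃ γ : TwoForm J, FaceSmooth J γ ∧ ∀ q ∈ openFace J, ∀ v : faceTangent J,
      prefForm J F q v = codifferential (fisherRao J) γ q v := by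
  have h3 : (3 : ℝ) ≤ J.card := by exact_mod_cast hJ
  have hne : J.Nonempty := Finset.card_pos.1 (by omega)
  have hc : -((J.card : ℝ) - 2)⁻¹ * (J.card - 2) = -1 := by
    have : (J.card : ℝ) - 2 ≠ 0 := by linarith
    rw [neg_mul, inv_mul_cancel₀ this]
  exact ⟨coutilityForm J _ F, faceSmooth_coutilityForm _ F, fun q hq v =>
    (codifferential_coutilityForm hF hc hne hq v).symm⟩

/-- The exact and co-exact parts together, on one face. -/
theorem decomposition_openFace {V S F : Matrix (Fin n) (Fin n) ℝ} (hV : V = S + F) (hS : Sᵀ = S)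
    (hF : Fᵀ = -F) (J : Finset (Fin n)) :
    (FaceSmooth J (prefForm J V) ∧
      ∀ q ∈ openFace J, prefForm J V q = prefForm J S q + prefForm J F q) ∧
    (FaceSmooth J (utility S) ∧
      ∀ q ∈ openFace J, prefForm J S q = faceDeriv J (utility S) q) ∧
    (3 ≤ J.card → ∃ γ : TwoForm J, FaceSmooth J γ ∧
      ∀ q ∈ openFace J, ∀ v : faceTangent J,
        prefForm J F q v = codifferential (fisherRao J) γ q v ∧
        prefForm J V q v =
          faceDeriv J (utility S) q v + codifferential (fisherRao J) γ q v) := by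
  subst hV
  refine ⟨⟨faceSmooth_prefForm _, fun q _ => prefForm_add S F q⟩,
    ⟨faceSmooth_utility S, fun q hq => prefForm_eq_faceDeriv_utility hS hq⟩, fun hJ => ?_⟩
  obtain ⟨γ, hγ, h⟩ := exists_eq_codifferential hF hJ
  refine ⟨γ, hγ, fun q hq v => ⟨h q hq v, ?_⟩⟩
  rw [prefForm_add, add_apply, prefForm_eq_faceDeriv_utility hS hq, h q hq v]

end PrefSimplex

end

theorem proposition1 (n : ℕ) (hn : 3 ≤ n) (V S F : Matrix (Fin n) (Fin n) ℝ)
    (hV : V = S + F) (hS : Sᵀ = S) (hF : Fᵀ = -F) :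
    -- on the open simplex, which is the open face with full support
    ((FaceSmooth Finset.univ (prefForm Finset.univ V) ∧
      ∀ q ∈ openFace Finset.univ,
        prefForm Finset.univ V q = prefForm Finset.univ S q + prefForm Finset.univ F q) ∧
     (FaceSmooth Finset.univ (utility S) ∧
      ∀ q ∈ openFace Finset.univ,
        prefForm Finset.univ S q = faceDeriv Finset.univ (utility S) q) ∧
     (∃ γ : TwoForm (Finset.univ : Finset (Fin n)), FaceSmooth Finset.univ γ ∧
      ∀ q ∈ openFace Finset.univ, ∀ v : faceTangent Finset.univ,
        prefForm Finset.univ F q v = codifferential (fisherRao Finset.univ) γ q v ∧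
        prefForm Finset.univ V q v =
          faceDeriv Finset.univ (utility S) q v +
            codifferential (fisherRao Finset.univ) γ q v)) ∧
    -- on every open face, with the co-exact part for supports of size at least three
    (∀ J : Finset (Fin n), J.Nonempty →
     (FaceSmooth J (prefForm J V) ∧
      ∀ q ∈ openFace J, prefForm J V q = prefForm J S q + prefForm J F q) ∧
     (FaceSmooth J (utility S) ∧
      ∀ q ∈ openFace J, prefForm J S q = faceDeriv J (utility S) q) ∧
     (3 ≤ J.card → ∃ γ : TwoForm J, FaceSmooth J γ ∧
      ∀ q ∈ openFace J, ∀ v : faceTangent J,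
        prefForm J F q v = codifferential (fisherRao J) γ q v ∧
        prefForm J V q v =
          faceDeriv J (utility S) q v + codifferential (fisherRao J) γ q v)) := by
  have huniv := decomposition_openFace hV hS hF (Finset.univ : Finset (Fin n))
  exact ⟨⟨huniv.1, huniv.2.1, huniv.2.2 (by simpa using hn)⟩,
    fun J _ => decomposition_openFace hV hS hF J⟩
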